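/- For $\gamma>0$ let $S_\gamma=\{z\in\mathbb C:\operatorname{Re}z>0,\ |\arg z|<\gamma\}$. For an element $a$ of a complex Banach algebra (not necessarily unital) let $\rho(a)$ denote its spectral radius (computed after adjoining a unit). Let $0<\alpha<\pi/2$ and $0\le\beta<\alpha$. Let $\mu$ be a complex Borel measure supported on a compact subset of $\{z\in\mathbb C:\operatorname{Re}z>0,\ |\arg z|\le\beta\}\subset S_\alpha$, with $\int d\mu=0$. Let $f(z)=\int e^{-z\xi}\,d\mu(\xi)$ be its Fourier--Borel transform, and let $\widetilde f(z)=\overline{f(\overline z)}$, which is the Fourier--Borel transform of the measure $\widetilde\mu(E)=\overline{\mu(\overline E)}$. Let $(T(t))_{t\in S_\alpha}$ be an analytic semigroup in a complex Banach algebra, i.e. $T$ is complex-differentiable in norm on $S_\alpha$ and $T(s+t)=T(s)T(t)$ for $s,t\in S_\alpha$; write $T(t)=\exp(tA)$ with $A$ its generator. Suppose that $T$ is not quasinilpotent, i.e. $\rho(T(t))\neq0$ for some $t\in S_\alpha$. Let $\mathcal A$ be the closed subalgebra generated by $(T(t))_{t\in S_\alpha}$, let $\operatorname{rad}\mathcal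 A=\{a\in\mathcal A:\rho(a)=0\}$, and let $\pi:\mathcal A\to\mathcal A/\operatorname{rad}\mathcal A$ be the canonical surjection. For $u\in S_{\alpha-\beta}$ put $$f(-uA)=\int T(u\xi)\,d\mu(\xi),\qquad \widetilde f(-uA)=\int T(u\xi)\,d\widetilde\mu(\xi)$$ (Bochner integrals). If there exists $t_0>0$ such that $$\sup_{t\in S_{\alpha-\beta},\ |t|\le t_0}\rho\bigl(f(-tA)\,\widetilde f(-tA)\bigr)<\sup_{z\in S_{\alpha-\beta}}|f(z)|\,|\widetilde f(z)|,$$ then $\mathcal A/\operatorname{rad}\mathcal A$ is unital and the generator of $(\pi(T(t)))_{t\in S_\alpha}$ is bounded; that is, with $e$ the unit of $\mathcal A/\operatorname{rad}\mathcal A$, there is $u\in\mathcal A/\operatorname{rad}\mathcal A$ such that $\pi(T(t))=\exp(tu)=e+\sum_{k\ge1}(tu)^k/k!$ for every $t\in S_\alpha$. -/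

import Mathlib

open MeasureTheory
open scoped ENNReal NNReal ComplexConjugate

noncomputable section

/-- The open sector `S_α = {z ∈ ℂ : Re z > 0, |arg z| < α}`. -/
def sector (α : ℝ) : Set ℂ := {z | 0 < z.re ∧ |z.arg| < α}

/-- The part `{z ∈ ℂ : Re z > 0, |arg z| ≤ β}` of the right half-plane. -/
def closedSector (β : ℝ) : Set ℂ := {z | 0 < z.re ∧ |z.arg| ≤ β}

/-! ### Spectral radius and radical in a Banach algebra which need not have a unit -/

section Radical

/-- The spectral radius of an element of a complex algebra that need not be unital: the spectral
radius in the algebra obtained by adjoining a unit. -/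
def rho {A : Type*} [NonUnitalRing A] [Module ℂ A] [IsScalarTower ℂ A A] [SMulCommClass ℂ A A]
    (a : A) : ℝ≥0∞ :=
  spectralRadius ℂ (a : Unitization ℂ A)

variable (A : Type*) [NonUnitalNormedCommRing A] [NormedSpace ℂ A] [IsScalarTower ℂ A A]
  [SMulCommClass ℂ A A]

/-- The Banach algebra obtained by adjoining a unit to `A` is commutative. -/
abbrev unitizationNormedCommRing : NormedCommRing (WithLp 1 (Unitization ℂ A)) :=
  { (inferInstance : NormedRing (WithLp 1 (Unitization ℂ A))) with
    mul_comm := fun x y => by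
      apply (WithLp.unitizationAlgEquiv (A := A) (𝕜 := ℂ) ℂ).injective
      simp only [map_mul]
      exact mul_comm _ _ }

variable {A}

theorem rho_eq_zero_iff [CompleteSpace A] (a : A) :
    rho a = 0 ↔ ∀ χ : WithLp 1 (Unitization ℂ A) →ₐ[ℂ] ℂ,
      χ (WithLp.toLp 1 (a : Unitization ℂ A)) = 0 := by
  let := unitizationNormedCommRing A
  set b : WithLp 1 (Unitization ℂ A) := WithLp.toLp 1 (a : Unitization ℂ A) with hb
  have hsp : spectrum ℂ b = spectrum ℂ (a : Unitization ℂ A) :=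
    (AlgEquiv.spectrum_eq (WithLp.unitizationAlgEquiv (A := A) (𝕜 := ℂ) ℂ) b).symm
  have h0 : rho a = 0 ↔ ∀ k ∈ spectrum ℂ b, k = 0 := by
    rw [hsp]
    simp [rho, spectralRadius]
  rw [h0]
  constructor
  · intro h χ
    exact h _ (AlgHom.apply_mem_spectrum χ b)
  · intro h k hk
    obtain ⟨f, hf⟩ := WeakDual.CharacterSpace.mem_spectrum_iff_exists.mp hk
    rw [← hf]
    exact h (WeakDual.CharacterSpace.toAlgHom f)

variable (A) in
/-- The radical of a commutative complex Banach algebra `A`: the elements of spectral radius `0`. -/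
def rad [CompleteSpace A] : Submodule ℂ A where
  carrier := {a | rho a = 0}
  add_mem' := by
    intro a b ha hb
    simp only [Set.mem_ofPred_eq, rho_eq_zero_iff] at *
    intro χ
    simp [ha χ, hb χ]
  zero_mem' := by
    simp only [Set.mem_ofPred_eq, rho_eq_zero_iff]
    intro χ
    simp
  smul_mem' := by
    intro c a ha
    simp only [Set.mem_ofPred_eq, rho_eq_zero_iff] at *
    intro χ
    simp [ha χ]

theorem mem_rad [CompleteSpace A] {a : A} : a ∈ rad A ↔ rho a = 0 := Iff.rfl

theorem mul_mem_rad [CompleteSpace A] (a : A) {b : A} (hb : b ∈ rad A) : a * b ∈ rad A := by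
  rw [mem_rad, rho_eq_zero_iff] at *
  intro χ
  have : WithLp.toLp 1 ((a * b : A) : Unitization ℂ A)
      = WithLp.toLp 1 (a : Unitization ℂ A) * WithLp.toLp 1 (b : Unitization ℂ A) := by
    apply (WithLp.unitizationAlgEquiv (A := A) (𝕜 := ℂ) ℂ).injective
    rw [map_mul]
    exact Unitization.inr_mul ℂ a b
  rw [this, map_mul, hb χ, mul_zero]

instance isClosed_rad [CompleteSpace A] : IsClosed (rad A : Set A) := by
  have : (rad A : Set A) = ⋂ χ : WithLp 1 (Unitization ℂ A) →ₐ[ℂ] ℂ,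
      {a : A | χ (WithLp.toLp 1 (a : Unitization ℂ A)) = 0} := by
    ext a
    simp only [SetLike.mem_coe, mem_rad, rho_eq_zero_iff, Set.mem_iInter, Set.mem_ofPred_eq]
  rw [this]
  refine isClosed_iInter fun χ => isClosed_eq ?_ continuous_const
  exact (map_continuous χ).comp (WithLp.unitization_isometry_inr (𝕜 := ℂ) (A := A)).continuous

/-- The product on `A / rad A`. -/
instance [CompleteSpace A] : Mul (A ⧸ rad A) where
  mul := Quotient.map₂ (· * ·) (by
    intro a₁ a₂ ha b₁ b₂ hb
    have ha' : a₁ - a₂ ∈ rad A := (Submodule.quotientRel_def _).mp ha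
    have hb' : b₁ - b₂ ∈ rad A := (Submodule.quotientRel_def _).mp hb
    refine (Submodule.quotientRel_def _).mpr ?_
    have : a₁ * b₁ - a₂ * b₂ = b₁ * (a₁ - a₂) + a₂ * (b₁ - b₂) := by
      rw [mul_sub, mul_sub, mul_comm b₁ a₁, mul_comm b₁ a₂]; abel
    rw [this]
    exact (rad A).add_mem (mul_mem_rad _ ha') (mul_mem_rad _ hb'))

theorem mk_mul_mk [CompleteSpace A] (a b : A) :
    (Submodule.Quotient.mk a * Submodule.Quotient.mk b : A ⧸ rad A)
      = Submodule.Quotient.mk (a * b) := rfl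

/-- `A / rad A`, with the quotient norm, is a commutative normed algebra. -/
instance [CompleteSpace A] : NonUnitalNormedCommRing (A ⧸ rad A) where
  __ := (inferInstance : NormedAddCommGroup (A ⧸ rad A))
  mul := (· * ·)
  left_distrib := by
    rintro ⟨a⟩ ⟨b⟩ ⟨c⟩
    exact congrArg Submodule.Quotient.mk (mul_add a b c)
  right_distrib := by
    rintro ⟨a⟩ ⟨b⟩ ⟨c⟩
    exact congrArg Submodule.Quotient.mk (add_mul a b c)
  zero_mul := by
    rintro ⟨a⟩
    exact congrArg Submodule.Quotient.mk (zero_mul a)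
  mul_zero := by
    rintro ⟨a⟩
    exact congrArg Submodule.Quotient.mk (mul_zero a)
  mul_assoc := by
    rintro ⟨a⟩ ⟨b⟩ ⟨c⟩
    exact congrArg Submodule.Quotient.mk (mul_assoc a b c)
  mul_comm := by
    rintro ⟨a⟩ ⟨b⟩
    exact congrArg Submodule.Quotient.mk (mul_comm a b)
  norm_mul_le := by
    intro x y
    have key : ∀ ε : ℝ, 0 < ε → ‖x * y‖ ≤ (‖x‖ + ε) * (‖y‖ + ε) := by
      intro ε hε
      obtain ⟨a, rfl, ha⟩ := Submodule.Quotient.norm_mk_lt x hε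
      obtain ⟨b, rfl, hb⟩ := Submodule.Quotient.norm_mk_lt y hε
      rw [mk_mul_mk]
      calc _ ≤ ‖a * b‖ := Submodule.Quotient.norm_mk_le _ _
        _ ≤ ‖a‖ * ‖b‖ := norm_mul_le a b
        _ ≤ _ := by gcongr
    have hlim : Filter.Tendsto (fun ε : ℝ => (‖x‖ + ε) * (‖y‖ + ε)) (nhdsWithin 0 (Set.Ioi 0))
        (nhds ((‖x‖ + 0) * (‖y‖ + 0))) := by
      apply Filter.Tendsto.mono_left _ nhdsWithin_le_nhds
      exact (by fun_prop : Continuous fun ε : ℝ => (‖x‖ + ε) * (‖y‖ + ε)).tendsto 0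
    have := ge_of_tendsto hlim (Filter.eventually_of_mem self_mem_nhdsWithin key)
    simpa using this

/-- `expTerm e v k` is `v ^ k / k!`, where `v ^ 0` is read as the unit `e`. -/
def expTerm {Q : Type*} [NonUnitalNormedCommRing Q] [NormedSpace ℂ Q] (e v : Q) : ℕ → Q
  | 0 => e
  | k + 1 => ((k + 1 : ℂ)⁻¹) • (v * expTerm e v k)

/-- A family `S` indexed by the sector `S_α`, in an algebra with unit `e`, has the bounded
generator `u`: `S t = exp (t u) = e + ∑_{k ≥ 1} (t u) ^ k / k!` for all `t`. -/
def HasBoundedGenerator {Q : Type*} [NonUnitalNormedCommRing Q] [NormedSpace ℂ Q] (e : Q) {α : ℝ}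
    (S : sector α → Q) : Prop :=
  ∃ u : Q, ∀ t : sector α, HasSum (expTerm e ((t : ℂ) • u)) (S t)

end Radical

/-! ### Analytic semigroups in a Banach algebra -/

section Semigroup

/-- An analytic semigroup `(T(t))_{t ∈ S_α}` in a complex normed algebra `B`. Only the values on the
sector `S_α` are relevant. -/
structure AnalyticSemigroup (α : ℝ) (B : Type*) [NonUnitalNormedRing B] [NormedSpace ℂ B] where
  toFun : ℂ → B
  differentiableOn : DifferentiableOn ℂ toFun (sector α)
  map_add : ∀ s ∈ sector α, ∀ t ∈ sector α, toFun (s + t) = toFun s * toFun t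

namespace AnalyticSemigroup

variable {α : ℝ} {B : Type*} [NonUnitalNormedRing B] [NormedSpace ℂ B]

instance : CoeFun (AnalyticSemigroup α B) (fun _ => ℂ → B) := ⟨toFun⟩

variable [IsScalarTower ℂ B B] [SMulCommClass ℂ B B] (T : AnalyticSemigroup α B)

/-- The semigroup is quasinilpotent: all its elements have spectral radius `0`. -/
def IsQuasinilpotent : Prop := ∀ t ∈ sector α, rho (T t) = 0

/-- The closed subalgebra of `B` generated by the semigroup. -/
def algebra : NonUnitalSubalgebra ℂ B :=
  (NonUnitalAlgebra.adjoin ℂ (T '' sector α)).topologicalClosure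

theorem algebra_mul_comm (x y : T.algebra) : x * y = y * x := by
  have hc : ∀ a ∈ T '' sector α, ∀ b ∈ T '' sector α, a * b = b * a := by
    rintro _ ⟨s, hs, rfl⟩ _ ⟨t, ht, rfl⟩
    rw [← T.map_add s hs t ht, ← T.map_add t ht s hs, add_comm]
  have := NonUnitalAlgebra.isMulCommutative_adjoin ℂ hc
  let := NonUnitalSubalgebra.nonUnitalCommRingTopologicalClosure
    (NonUnitalAlgebra.adjoin ℂ (T '' sector α)) (fun a b => mul_comm' a b)
  exact mul_comm (G := (NonUnitalAlgebra.adjoin ℂ (T '' sector α)).topologicalClosure) x y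

instance : NonUnitalNormedCommRing T.algebra :=
  { (inferInstance : NonUnitalNormedRing T.algebra) with mul_comm := T.algebra_mul_comm }

instance : NormedSpace ℂ T.algebra where
  norm_smul_le c x := norm_smul_le c (x : B)

instance [CompleteSpace B] : CompleteSpace T.algebra :=
  (NonUnitalSubalgebra.isClosed_topologicalClosure _).completeSpace_coe

/-- The element `T(t)` of the closed algebra generated by the semigroup. -/
def toAlgebra (t : sector α) : T.algebra :=
  ⟨T t, NonUnitalSubalgebra.le_topologicalClosure _
    (NonUnitalAlgebra.subset_adjoin ℂ ⟨t, t.2, rfl⟩)⟩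

end AnalyticSemigroup

end Semigroup

/-! ### Measures, Fourier--Borel transforms and functional calculus -/

section Calculus

/-- The integral of a vector-valued function against a complex measure. -/
def cintegral {B : Type*} [NormedAddCommGroup B] [NormedSpace ℂ B] (μ : ComplexMeasure ℂ)
    (g : ℂ → B) : B :=
  VectorMeasure.integral μ g (ContinuousLinearMap.lsmul ℝ ℂ).flip

/-- The Fourier--Borel transform `z ↦ ∫ exp (-z ξ) dμ(ξ)`. -/
def fourierBorel (μ : ComplexMeasure ℂ) (z : ℂ) : ℂ := cintegral μ fun ξ => Complex.exp (-z * ξ)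

/-- The complex measure `S ↦ conj (μ (conj S))`. -/
def conjMeasure (μ : ComplexMeasure ℂ) : ComplexMeasure ℂ :=
  (μ.map (fun z => conj z)).mapRange (starRingEnd ℂ : ℂ →+* ℂ).toAddMonoidHom
    Complex.continuous_conj

theorem conjMeasure_apply (μ : ComplexMeasure ℂ) {S : Set ℂ} (hS : MeasurableSet S) :
    conjMeasure μ S = conj (μ ((fun z => conj z) ⁻¹' S)) := by
  simp [conjMeasure, VectorMeasure.map_apply _ (Complex.continuous_conj.measurable) hS]

/-- The functional calculus `f(-uA) = ∫ T(u ξ) dμ(ξ)`, where `f` is the Fourier--Borel transform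
of `μ` and `A` is the generator of the semigroup `T`. -/
def functionalCalculus {α : ℝ} {B : Type*} [NonUnitalNormedRing B] [NormedSpace ℂ B]
    (T : AnalyticSemigroup α B) (μ : ComplexMeasure ℂ) (u : ℂ) : B :=
  cintegral μ fun ξ => T (u * ξ)

end Calculus

end

/-!
Let `φ` be a character of the closed algebra generated by `T` which does not vanish on `T`. Then
`φ (T t) = exp (-l t)` for an exponent `l`, and `φ (f(-tA)) = f(l t)`. Put `F = f f~`, so that
`|F (conj z)| = |F z|`, and let `C` lie strictly between the two suprema: then `|F (l t)| ≤ C` for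
every exponent `l` and every small `t ∈ S_{α-β}`.

Suppose that the exponents are unbounded, and let `ω ≠ 0` be a limit of `c_n l_n` with exponents
`l_n` and positive reals `c_n → 0`. As `|φ (T t)| ≤ ‖T t‖`, the real part of `l t` is bounded below
in `l` for each `t ∈ S_α`, so `|arg ω| ≤ π/2 - α`. Since `c_n t` is small for large `n`, the bound
passes to the limit: `|F (ω t)| ≤ C` for all `t ∈ S_{α-β}`. Given `z ∈ S_{α-β}`, let
`|ψ| = |arg ω| + |arg z|`, with `ψ` of the sign of `arg ω`. Then `|F| ≤ C` on the ray of angle `ψ`,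
and by symmetry on the ray of angle `-ψ`. As `|ψ| < π/2 - β`, the function `F` is bounded between
these rays, so `|F z| ≤ C` by the Phragmén-Lindelöf principle. This contradicts the choice of `C`.

Hence the exponents are bounded, and for small `τ > 0` every character takes `T τ` either to `0` or
close to `1`. The Riesz integrals of `1` and of `τ⁻¹ log` around `1` are elements which give, modulo
the radical, the unit and the bounded generator.
-/

noncomputable section

open Bornology Complex Filter Metric Set
open scoped Real Topology

/-! ### Sectors -/

section Sector

variable {α β : ℝ} {s t z : ℂ}

theorem mem_sector_iff (hα : α ≤ π / 2) : z ∈ sector α ↔ z ≠ 0 ∧ |z.arg| < α := by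
  refine and_congr_left fun harg => ⟨?_, fun hz => ?_⟩
  · rintro hre rfl
    exact lt_irrefl _ hre
  · exact (abs_arg_lt_pi_div_two_iff.mp (harg.trans_le hα)).resolve_right hz

theorem ne_zero_of_mem_sector (hz : z ∈ sector α) : z ≠ 0 := by
  rintro rfl
  exact lt_irrefl _ hz.1

theorem ne_zero_of_mem_closedSector (hz : z ∈ closedSector β) : z ≠ 0 := by
  rintro rfl
  exact lt_irrefl _ hz.1

theorem arg_ne_pi_of_re_pos (hz : 0 < z.re) : z.arg ≠ π := fun h =>
  hz.not_gt (arg_eq_pi_iff.mp h).1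

theorem exp_mem_sector (hα : α ≤ π / 2) (hz : |z.im| < α) : exp z ∈ sector α := by
  obtain ⟨hl, hr⟩ := abs_lt.mp hz
  rw [mem_sector_iff hα, ← log_im, log_exp (by linarith) (by linarith)]
  exact ⟨exp_ne_zero z, hz⟩

theorem ofReal_mul_mem_sector {r : ℝ} (hr : 0 < r) (hz : z ∈ sector α) : r * z ∈ sector α :=
  ⟨by simpa using mul_pos hr hz.1, by simpa [arg_real_mul z hr] using hz.2⟩

theorem ofReal_mem_sector {r : ℝ} (hα : 0 < α) (hr : 0 < r) : (r : ℂ) ∈ sector α :=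
  ⟨by simpa using hr, by simpa [arg_ofReal_of_nonneg hr.le] using hα⟩

theorem conj_mem_sector (hz : z ∈ sector α) : conj z ∈ sector α := by
  refine ⟨by simpa using hz.1, ?_⟩
  rw [arg_conj, if_neg (arg_ne_pi_of_re_pos hz.1), abs_neg]
  exact hz.2

theorem conj_mem_closedSector (hz : z ∈ closedSector β) : conj z ∈ closedSector β := by
  refine ⟨by simpa using hz.1, ?_⟩
  rw [arg_conj, if_neg (arg_ne_pi_of_re_pos hz.1), abs_neg]
  exact hz.2

theorem mul_mem_sector (hα : α ≤ π / 2) (hs : s ∈ sector (α - β)) (ht : t ∈ closedSector β) :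
    s * t ∈ sector α := by
  have := Real.pi_pos
  have hs0 := ne_zero_of_mem_sector hs
  have ht0 := ne_zero_of_mem_closedSector ht
  obtain ⟨hs₁, hs₂⟩ := abs_lt.mp hs.2
  obtain ⟨ht₁, ht₂⟩ := abs_le.mp ht.2
  rw [mem_sector_iff hα, arg_mul hs0 ht0 ⟨by linarith, by linarith⟩]
  exact ⟨mul_ne_zero hs0 ht0, abs_lt.mpr ⟨by linarith, by linarith⟩⟩

theorem mem_sector_iff_abs_im_mul_cos_lt (hα₀ : 0 < α) (hα : α ≤ π / 2) :
    z ∈ sector α ↔ |z.im| * Real.cos α < z.re * Real.sin α := by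
  have := Real.pi_pos
  have harg := abs_arg_le_pi z
  have key : z.re * Real.sin α - |z.im| * Real.cos α = ‖z‖ * Real.sin (α - |z.arg|) := by
    rw [Real.sin_sub, Real.cos_abs, ← Real.abs_sin_eq_sin_abs_of_abs_le_pi harg,
      ← norm_mul_cos_arg z, ← norm_mul_sin_arg z, abs_mul, abs_norm]
    ring
  rw [mem_sector_iff hα, ← sub_pos (b := |z.im| * Real.cos α), key]
  constructor
  · rintro ⟨hz, hlt⟩
    exact mul_pos (norm_pos_iff.mpr hz)
      (Real.sin_pos_of_pos_of_lt_pi (by linarith) (by linarith [abs_nonneg z.arg]))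
  · refine fun h => ⟨fun hz => by simp [hz] at h, ?_⟩
    by_contra! hle
    exact (pos_of_mul_pos_right h (norm_nonneg z)).not_ge
      (Real.sin_nonpos_of_nonpos_of_neg_pi_le (by linarith) (by linarith))

theorem isOpen_sector (hα₀ : 0 < α) (hα : α ≤ π / 2) : IsOpen (sector α) := by
  have : sector α = {z : ℂ | |z.im| * Real.cos α < z.re * Real.sin α} :=
    Set.ext fun _ => mem_sector_iff_abs_im_mul_cos_lt hα₀ hα
  rw [this]
  exact isOpen_lt (by fun_prop) (by fun_prop)

theorem add_mem_sector (hα₀ : 0 < α) (hα : α ≤ π / 2) (hs : s ∈ sector α) (ht : t ∈ sector α) :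
    s + t ∈ sector α := by
  rw [mem_sector_iff_abs_im_mul_cos_lt hα₀ hα] at *
  have hcos : 0 ≤ Real.cos α := Real.cos_nonneg_of_mem_Icc ⟨by linarith, hα⟩
  calc |(s + t).im| * Real.cos α ≤ (|s.im| + |t.im|) * Real.cos α := by
        gcongr
        exact abs_add_le s.im t.im
    _ < (s + t).re * Real.sin α := by
        rw [add_re]
        linarith

theorem convex_sector (hα₀ : 0 < α) (hα : α ≤ π / 2) : Convex ℝ (sector α) := by
  rw [convex_iff_forall_pos]
  intro x hx y hy a b ha hb _
  simpa only [real_smul] using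
    add_mem_sector hα₀ hα (ofReal_mul_mem_sector ha hx) (ofReal_mul_mem_sector hb hy)

theorem exists_abs_eq_and_abs_add_eq (x : ℝ) {y : ℝ} (hy : 0 ≤ y) :
    ∃ φ : ℝ, |φ| = y ∧ |x + φ| = |x| + y := by
  rcases le_total 0 x with hx | hx
  · exact ⟨y, abs_of_nonneg hy, by rw [abs_of_nonneg hx, abs_of_nonneg (by positivity)]⟩
  · refine ⟨-y, by rw [abs_neg, abs_of_nonneg hy], ?_⟩
    rw [abs_of_nonpos hx, abs_of_nonpos (by linarith)]
    ring

theorem mul_exp_eq_ofReal_mul_exp (z w : ℂ) :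
    z * exp w = (‖z‖ * Real.exp w.re : ℝ) * exp ((z.arg + w.im : ℝ) * I) := by
  conv_lhs => rw [← norm_mul_exp_arg_mul_I z, ← re_add_im w]
  push_cast
  simp only [exp_add, add_mul]
  ring

theorem abs_arg_le_of_forall_re_mul_nonneg (hα₀ : 0 < α) (hα : α ≤ π / 2)
    (h : ∀ t ∈ sector α, 0 ≤ (z * t).re) : |z.arg| ≤ π / 2 - α := by
  have := Real.pi_pos
  by_contra! hlt
  have hz : z ≠ 0 := by
    rintro rfl
    simp only [arg_zero, abs_zero] at hlt
    linarith
  have harg := abs_arg_le_pi z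
  obtain ⟨y, hy, hyα⟩ : ∃ y, max (π / 2 - |z.arg|) 0 < y ∧ y < α :=
    exists_between (max_lt (by linarith) hα₀)
  obtain ⟨hy₁, hy₀⟩ := max_lt_iff.mp hy
  obtain ⟨φ, hφ, hφz⟩ := exists_abs_eq_and_abs_add_eq z.arg hy₀.le
  have hre := h _ (exp_mem_sector hα (z := φ * I) (by simpa [hφ]))
  have hcos : Real.cos (z.arg + φ) < 0 := by
    rw [← Real.cos_abs, hφz]
    exact Real.cos_neg_of_pi_div_two_lt_of_lt (by linarith) (by linarith)
  rw [mul_exp_eq_ofReal_mul_exp, re_ofReal_mul, exp_ofReal_mul_I_re] at hre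
  simp only [re_ofReal_mul, im_ofReal_mul, I_re, I_im, mul_zero, mul_one, Real.exp_zero] at hre
  exact (mul_neg_of_pos_of_neg (norm_pos_iff.mpr hz) hcos).not_ge hre

end Sector

/-! ### Functions bounded near infinity in a sector -/

section MaximumPrinciple

variable {E : Type*} [NormedAddCommGroup E] [NormedSpace ℂ E] {F : ℂ → E} {C M γ ψ : ℝ}

theorem diffContOnCl_comp_exp (hF : DifferentiableOn ℂ F (sector γ)) (hγ : γ ≤ π / 2)
    (hψ : |ψ| < γ) :
    DiffContOnCl ℂ (F ∘ exp) (im ⁻¹' Ioo (-|ψ|) |ψ|) := by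
  refine DifferentiableOn.diffContOnCl (hF.comp differentiable_exp.differentiableOn fun w hw => ?_)
  have hw' : w ∈ im ⁻¹' Icc (-|ψ|) |ψ| :=
    closure_minimal (preimage_mono Ioo_subset_Icc_self) (isClosed_Icc.preimage continuous_im) hw
  have him : |w.im| ≤ |ψ| := abs_le.mpr hw'
  exact exp_mem_sector hγ (him.trans_lt hψ)

/-- Pulled back along `exp`, a sector becomes a horizontal strip and the symmetry turns the bound
on the upper edge into one on the lower edge, so that the Phragmén-Lindelöf principle applies. -/
theorem norm_le_of_norm_le_on_ray (hF : DifferentiableOn ℂ F (sector γ))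
    (hsymm : ∀ z, ‖F (conj z)‖ = ‖F z‖) (hM : ∀ z ∈ sector γ, ‖F z‖ ≤ M)
    (hγ : γ ≤ π / 2) (hψ : |ψ| < γ) (hray : ∀ w : ℂ, w.im = ψ → ‖F (exp w)‖ ≤ C)
    {z : ℂ} (hz : z ≠ 0) (hzψ : |z.arg| ≤ |ψ|) : ‖F z‖ ≤ C := by
  have hedge : ∀ w : ℂ, |w.im| = |ψ| → ‖F (exp w)‖ ≤ C := fun w hw => by
    rcases abs_eq_abs.mp hw with h | h
    · exact hray w h
    · simpa [exp_conj, hsymm] using hray (conj w) (by simp [h])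
  have hpos := abs_nonneg ψ
  have hbound : ∀ w ∈ im ⁻¹' Ioo (-|ψ|) |ψ|, ‖F (exp w)‖ ≤ M := fun w hw =>
    hM _ (exp_mem_sector hγ ((abs_lt.mpr hw).trans hψ))
  have hgrowth : ∃ c < π / (|ψ| - -|ψ|), ∃ B, (F ∘ exp) =O[comap (_root_.abs ∘ re) atTop ⊓
      𝓟 (im ⁻¹' Ioo (-|ψ|) |ψ|)] fun w => Real.exp (B * Real.exp (c * |w.re|)) := by
    refine ⟨-1, neg_one_lt_zero.trans_le (div_nonneg Real.pi_pos.le (by linarith)), 0, ?_⟩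
    refine Asymptotics.IsBigO.of_bound M ?_
    filter_upwards [mem_inf_of_right (mem_principal_self _)] with w hw
    simpa using hbound w hw
  have := PhragmenLindelof.horizontal_strip (z := log z) (diffContOnCl_comp_exp hF hγ hψ) hgrowth
    (fun w hw => hedge w (by rw [hw, abs_neg, abs_abs]))
    (fun w hw => hedge w (by rw [hw, abs_abs]))
    (abs_le.mp (by rwa [log_im])).1 (abs_le.mp (by rwa [log_im])).2
  rwa [Function.comp_apply, exp_log hz] at this

end MaximumPrinciple

/-! ### Asymptotic cones -/

section AsymptoticCone

theorem mem_asymptoticCone_iff_frequently_smul_mem {V : Type*} [NormedAddCommGroup V]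
    [NormedSpace ℝ V] {Λ : Set V} {v : V} :
    v ∈ asymptoticCone ℝ Λ ↔ ∃ᶠ p : ℝ × V in atTop ×ˢ 𝓝 v, p.1 • p.2 ∈ Λ := by
  rw [mem_asymptoticCone_iff, AffineSpace.asymptoticNhds_eq_smul, ← map₂_smul,
    ← map_prod_eq_map₂, frequently_map]

theorem nonneg_of_mem_asymptoticCone {V : Type*} [NormedAddCommGroup V] [NormedSpace ℝ V]
    {Λ : Set V} {v : V} (hv : v ∈ asymptoticCone ℝ Λ) {L : StrongDual ℝ V}
    (hL : BddBelow (L '' Λ)) : 0 ≤ L v := by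
  obtain ⟨m, hm⟩ := hL
  have hlim : Tendsto (fun p : ℝ × V => p.1⁻¹ * m) (atTop ×ˢ 𝓝 v) (𝓝 0) := by
    simpa using (tendsto_inv_atTop_zero.comp tendsto_fst).mul_const m
  have hLlim : Tendsto (fun p : ℝ × V => L p.2) (atTop ×ˢ 𝓝 v) (𝓝 (L v)) :=
    (L.continuous.tendsto v).comp tendsto_snd
  refine le_of_tendsto_of_tendsto_of_frequently hlim hLlim ?_
  have hpos : ∀ᶠ p : ℝ × V in atTop ×ˢ 𝓝 v, 0 < p.1 := tendsto_fst.eventually_gt_atTop 0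
  refine ((mem_asymptoticCone_iff_frequently_smul_mem.mp hv).and_eventually hpos).mono ?_
  rintro ⟨r, w⟩ ⟨hrw, hr⟩
  rw [inv_mul_le_iff₀ hr, ← smul_eq_mul, ← map_smul]
  exact hm (mem_image_of_mem L hrw)

theorem norm_mul_le_of_mem_asymptoticCone {E : Type*} [NormedAddCommGroup E] {F : ℂ → E}
    (hF : Continuous F) {Λ : Set ℂ} {t₀ C : ℝ} (ht₀ : 0 < t₀) {t : ℂ}
    (hC : ∀ r : ℝ, 0 < r → ‖r * t‖ ≤ t₀ → ∀ l ∈ Λ, ‖F (l * (r * t))‖ ≤ C)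
    {ω : ℂ} (hω : ω ∈ asymptoticCone ℝ Λ) : ‖F (ω * t)‖ ≤ C := by
  have hlim : Tendsto (fun p : ℝ × ℂ => ‖F (p.2 * t)‖) (atTop ×ˢ 𝓝 ω) (𝓝 ‖F (ω * t)‖) :=
    (Continuous.tendsto (by fun_prop : Continuous fun w => ‖F (w * t)‖) ω).comp tendsto_snd
  refine le_of_tendsto_of_frequently hlim ?_
  have hpos : ∀ᶠ p : ℝ × ℂ in atTop ×ˢ 𝓝 ω, 0 < p.1 := tendsto_fst.eventually_gt_atTop 0
  have hsmall : ∀ᶠ p : ℝ × ℂ in atTop ×ˢ 𝓝 ω, p.1⁻¹ * ‖t‖ ≤ t₀ := by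
    have : Tendsto (fun p : ℝ × ℂ => p.1⁻¹ * ‖t‖) (atTop ×ˢ 𝓝 ω) (𝓝 0) := by
      simpa using (tendsto_inv_atTop_zero.comp tendsto_fst).mul_const ‖t‖
    exact this.eventually_le_const ht₀
  refine ((mem_asymptoticCone_iff_frequently_smul_mem.mp hω).and_eventually
    (hpos.and hsmall)).mono ?_
  rintro ⟨r, w⟩ ⟨hrw, hr : 0 < r, hrt⟩
  have hmul : r • w * ((r⁻¹ : ℝ) * t) = w * t := by
    have : (r : ℂ) ≠ 0 := ofReal_ne_zero.mpr hr.ne'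
    rw [real_smul, ofReal_inv]
    field_simp
  rw [← hmul]
  refine hC r⁻¹ (inv_pos.mpr hr) ?_ _ hrw
  rwa [norm_mul, norm_real, Real.norm_of_nonneg (inv_nonneg.mpr hr.le)]

end AsymptoticCone

/-! ### Sets of exponents -/

section Boundedness

variable {E : Type*} [NormedAddCommGroup E] [NormedSpace ℂ E] {F : ℂ → E} {α β C M t₀ : ℝ}

theorem norm_le_of_forall_norm_mul_le (hF : Differentiable ℂ F)
    (hsymm : ∀ z, ‖F (conj z)‖ = ‖F z‖) (hM : ∀ z ∈ sector (π / 2 - β), ‖F z‖ ≤ M)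
    (hα : α ≤ π / 2) (hβ : 0 ≤ β) {ω : ℂ} (hω₀ : ω ≠ 0) (hω : |ω.arg| ≤ π / 2 - α)
    (hC : ∀ t ∈ sector (α - β), ‖F (ω * t)‖ ≤ C) {z : ℂ} (hz : z ∈ sector (α - β)) :
    ‖F z‖ ≤ C := by
  obtain ⟨φ, hφ, hφω⟩ := exists_abs_eq_and_abs_add_eq ω.arg (abs_nonneg z.arg)
  have hψ : |ω.arg + φ| < π / 2 - β := by
    rw [hφω]
    linarith [hz.2]
  have hzψ : |z.arg| ≤ |ω.arg + φ| := by
    rw [hφω]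
    exact le_add_of_nonneg_left (abs_nonneg _)
  refine norm_le_of_norm_le_on_ray hF.differentiableOn hsymm hM (by linarith) hψ (fun w hw => ?_)
    (ne_zero_of_mem_sector hz) hzψ
  have him : |(w - log ω).im| < α - β := by
    rw [sub_im, log_im, hw, add_sub_cancel_left, hφ]
    exact hz.2
  simpa only [exp_sub, exp_log hω₀, mul_div_cancel₀ _ hω₀] using
    hC _ (exp_mem_sector (by linarith) him)

theorem isBounded_of_forall_norm_mul_le (hα₀ : 0 < α) (hα : α ≤ π / 2) (hβ : 0 ≤ β)
    (hF : Differentiable ℂ F) (hsymm : ∀ z, ‖F (conj z)‖ = ‖F z‖)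
    (hM : ∀ z ∈ sector (π / 2 - β), ‖F z‖ ≤ M) {Λ : Set ℂ}
    (hΛ : ∀ t ∈ sector α, BddBelow ((fun l => (l * t).re) '' Λ)) (ht₀ : 0 < t₀)
    (hC : ∀ t ∈ sector (α - β), ‖t‖ ≤ t₀ → ∀ l ∈ Λ, ‖F (l * t)‖ ≤ C)
    {z : ℂ} (hz : z ∈ sector (α - β)) (hCz : C < ‖F z‖) : IsBounded Λ := by
  by_contra hunbounded
  obtain ⟨ω, hω₀, hω⟩ := not_bounded_iff_exists_ne_zero_mem_asymptoticCone.mp hunbounded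
  have harg : |ω.arg| ≤ π / 2 - α :=
    abs_arg_le_of_forall_re_mul_nonneg hα₀ hα fun t ht =>
      nonneg_of_mem_asymptoticCone (L := reCLM ∘L (ContinuousLinearMap.mul ℝ ℂ).flip t) hω (hΛ t ht)
  refine hCz.not_ge (norm_le_of_forall_norm_mul_le hF hsymm hM hα hβ hω₀ harg (fun t ht => ?_) hz)
  exact norm_mul_le_of_mem_asymptoticCone hF.continuous ht₀
    (fun r hr hrt => hC _ (ofReal_mul_mem_sector hr ht) hrt) hω

end Boundedness

/-! ### Integration against complex measures -/

section ComplexMeasure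

instance isFiniteMeasure_variation {X : Type*} [MeasurableSpace X] (μ : ComplexMeasure X) :
    IsFiniteMeasure μ.variation := by
  refine isFiniteMeasure_of_le ((ComplexMeasure.re μ).totalVariation +
    (ComplexMeasure.im μ).totalVariation)
    (VectorMeasure.variation_le_of_forall_enorm_le fun s _ => ?_)
  calc ‖μ s‖ₑ = ‖((μ s).re : ℂ) + (μ s).im * I‖ₑ := by rw [re_add_im]
    _ ≤ ‖((μ s).re : ℂ)‖ₑ + ‖(μ s).im * I‖ₑ := enorm_add_le _ _
    _ = ‖(μ s).re‖ₑ + ‖(μ s).im‖ₑ := by simp [← ofReal_norm]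
    _ ≤ _ := add_le_add (SignedMeasure.enorm_le_totalVariation (ComplexMeasure.re μ) s)
      (SignedMeasure.enorm_le_totalVariation (ComplexMeasure.im μ) s)

variable {μ : ComplexMeasure ℂ} {K : Set ℂ} {E E' : Type*} [NormedAddCommGroup E]

theorem ae_mem_of_forall_disjoint (hK : MeasurableSet K)
    (hμK : ∀ s : Set ℂ, MeasurableSet s → Disjoint s K → μ s = 0) : ∀ᵐ ξ ∂μ.variation, ξ ∈ K := by
  have : μ.variation Kᶜ = 0 := by
    rw [VectorMeasure.variation_apply_eq_zero hK.compl]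
    exact fun s hs hsm => hμK s hsm (disjoint_compl_left.mono_left hs)
  exact this

theorem integrable_of_continuousOn (hK : IsCompact K) (hμK : ∀ᵐ ξ ∂μ.variation, ξ ∈ K)
    {g : ℂ → E} (hg : ContinuousOn g K) : μ.Integrable g := by
  have := hg.integrableOn_compact (μ := μ.variation) hK
  rwa [IntegrableOn, Measure.restrict_eq_self_of_ae_mem hμK] at this

variable [NormedSpace ℂ E] [NormedAddCommGroup E'] [NormedSpace ℂ E']

theorem map_cintegral [CompleteSpace E] [CompleteSpace E'] (L : E →L[ℂ] E') {g : ℂ → E}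
    (hg : μ.Integrable g) : L (cintegral μ g) = cintegral μ fun ξ => L (g ξ) := by
  have h₁ := VectorMeasure.continuousLinearMap_apply_integral (C := L.restrictScalars ℝ)
    (B := (ContinuousLinearMap.lsmul ℝ ℂ).flip) hg
  have h₂ := VectorMeasure.integral_continuousLinearMap_comp (C := L.restrictScalars ℝ)
    (B := (ContinuousLinearMap.lsmul ℝ ℂ).flip) hg
  refine h₁.trans (Eq.trans ?_ h₂.symm)
  congr 1
  ext
  simp

theorem variation_conjMeasure_le : (conjMeasure μ).variation ≤ μ.variation.map conj := by
  refine VectorMeasure.variation_le_of_forall_enorm_le fun s hs => ?_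
  rw [conjMeasure_apply μ hs, Measure.map_apply continuous_conj.measurable hs, RCLike.enorm_conj]
  exact VectorMeasure.enorm_measure_le_variation μ _

theorem ae_mem_conjMeasure (hK : MeasurableSet K) (hμK : ∀ᵐ ξ ∂μ.variation, ξ ∈ K) :
    ∀ᵐ ξ ∂(conjMeasure μ).variation, ξ ∈ conj ⁻¹' K := by
  refine ae_mono variation_conjMeasure_le ?_
  refine (ae_map_iff continuous_conj.aemeasurable (continuous_conj.measurable hK)).mpr ?_
  simpa only [mem_preimage, conj_conj] using hμK

theorem integral_conjMeasure {g : ℂ → E} (hg : Continuous g)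
    (hgμ : μ.Integrable fun ξ => g (conj ξ)) (P : E →L[ℝ] ℂ →L[ℝ] E) :
    (conjMeasure μ).integral g P =
      μ.integral (fun ξ => g (conj ξ)) (P.bilinearComp (.id ℝ E) (conjCLE : ℂ →L[ℝ] ℂ)) := by
  refine setToFun_of_le_map _ _ hgμ hg.aestronglyMeasurable continuous_conj.measurable
    variation_conjMeasure_le fun s x hs => ?_
  simp [transpose_eq_cbmApplyMeasure, conjMeasure_apply μ hs]

theorem cintegral_conjMeasure {g : ℂ → ℂ} (hg : Continuous g)
    (hgμ : μ.Integrable fun ξ => g (conj ξ)) :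
    cintegral (conjMeasure μ) g = conj (cintegral μ fun ξ => conj (g (conj ξ))) := by
  have hgμ' : μ.Integrable fun ξ => conj (g (conj ξ)) :=
    (conjCLE : ℂ →L[ℝ] ℂ).integrable_comp hgμ
  have h₁ := VectorMeasure.continuousLinearMap_apply_integral (C := (conjCLE : ℂ →L[ℝ] ℂ))
    (B := (ContinuousLinearMap.lsmul ℝ ℂ).flip) hgμ'
  have h₂ := VectorMeasure.integral_continuousLinearMap_comp (C := (conjCLE : ℂ →L[ℝ] ℂ))
    (B := ContinuousLinearMap.compL ℝ ℂ ℂ ℂ (conjCLE : ℂ →L[ℝ] ℂ) ∘L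
      (ContinuousLinearMap.lsmul ℝ ℂ).flip) hgμ
  refine (integral_conjMeasure hg hgμ _).trans (Eq.trans ?_ (h₁.trans h₂).symm)
  congr 1
  ext
  simp

theorem hasDerivAt_cintegral {g : ℂ → ℂ → E} {g' : ℂ → E} {z : ℂ} {C : ℝ} [CompleteSpace E]
    (hg : ∀ w, μ.Integrable (g w)) (hderiv : ∀ ξ, HasDerivAt (fun w => g w ξ) (g' ξ) z)
    (hC : ∀ᶠ w in 𝓝[≠] z, ∀ᵐ ξ ∂μ.variation, ‖slope (fun w => g w ξ) z w‖ ≤ C) :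
    HasDerivAt (fun w => cintegral μ (g w)) (cintegral μ g') z := by
  rw [hasDerivAt_iff_tendsto_slope]
  have hslope : ∀ w, slope (fun w => cintegral μ (g w)) z w =
      cintegral μ fun ξ => slope (fun w => g w ξ) z w := fun w => by
    have hmap := map_cintegral ((w - z)⁻¹ • ContinuousLinearMap.id ℂ E) ((hg w).sub (hg z))
    have hsub : cintegral μ (g w - g z) = cintegral μ (g w) - cintegral μ (g z) :=
      VectorMeasure.integral_sub (hg w) (hg z)
    rw [hsub] at hmap
    simpa [slope_def_module] using hmap
  refine Tendsto.congr (fun w => (hslope w).symm) ?_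
  refine VectorMeasure.tendsto_integral_filter_of_norm_le_const (.of_forall fun w => ?_) ⟨C, hC⟩
    (.of_forall fun ξ => hasDerivAt_iff_tendsto_slope.mp (hderiv ξ))
  simp only [slope_def_module]
  exact ((hg w).1.sub (hg z).1).const_smul _

end ComplexMeasure

/-! ### The Fourier-Borel transform -/

section FourierBorel

variable {μ : ComplexMeasure ℂ} {K : Set ℂ}

theorem fourierBorel_conjMeasure (hK : IsCompact K) (hμK : ∀ᵐ ξ ∂μ.variation, ξ ∈ K) (z : ℂ) :
    fourierBorel (conjMeasure μ) z = conj (fourierBorel μ (conj z)) := by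
  rw [fourierBorel, cintegral_conjMeasure (by fun_prop)
    (integrable_of_continuousOn hK hμK (by fun_prop))]
  simp only [fourierBorel, ← exp_conj, map_mul, map_neg, conj_conj]

theorem norm_slope_exp_neg_mul_le {z w ξ : ℂ} {R : ℝ} (hw : w ∈ closedBall z 1) (hξ : ‖ξ‖ ≤ R) :
    ‖slope (fun w => exp (-w * ξ)) z w‖ ≤ Real.exp ((‖z‖ + 1) * R) * R := by
  have hR : 0 ≤ R := (norm_nonneg ξ).trans hξ
  have hderiv : ∀ v, HasDerivAt (fun w => exp (-w * ξ)) (exp (-v * ξ) * (-1 * ξ)) v := fun v =>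
    ((hasDerivAt_neg v).mul_const ξ).cexp
  have hbound : ∀ v ∈ closedBall z 1,
      ‖exp (-v * ξ) * (-1 * ξ)‖ ≤ Real.exp ((‖z‖ + 1) * R) * R := fun v hv => by
    have hvξ : ‖-v * ξ‖ ≤ (‖z‖ + 1) * R := by
      rw [norm_mul, norm_neg]
      gcongr
      exact norm_le_of_mem_closedBall hv
    rw [norm_mul]
    gcongr
    · exact (norm_exp_le_exp_norm _).trans (Real.exp_le_exp.mpr hvξ)
    · simpa using hξ
  have hmean := (convex_closedBall z 1).norm_image_sub_le_of_norm_hasDerivWithin_le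
    (fun v _ => (hderiv v).hasDerivWithinAt) hbound (mem_closedBall_self zero_le_one) hw
  rw [slope_def_module, norm_smul, norm_inv]
  exact inv_mul_le_of_le_mul₀ (norm_nonneg _) (by positivity) (by rwa [mul_comm ‖w - z‖])

theorem differentiable_fourierBorel (hK : IsCompact K) (hμK : ∀ᵐ ξ ∂μ.variation, ξ ∈ K) :
    Differentiable ℂ (fourierBorel μ) := fun z => by
  obtain ⟨R, hR⟩ := hK.isBounded.exists_norm_le
  refine (hasDerivAt_cintegral (g' := fun ξ => exp (-z * ξ) * (-1 * ξ))
    (C := Real.exp ((‖z‖ + 1) * R) * R)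
    (fun w => integrable_of_continuousOn hK hμK (by fun_prop))
    (fun ξ => ((hasDerivAt_neg z).mul_const ξ).cexp) ?_).differentiableAt
  filter_upwards [nhdsWithin_le_nhds (closedBall_mem_nhds z one_pos)] with w hw
  exact hμK.mono fun ξ hξ => norm_slope_exp_neg_mul_le hw (hR ξ hξ)

theorem norm_fourierBorel_le {β : ℝ} (hμβ : ∀ᵐ ξ ∂μ.variation, ξ ∈ closedSector β) {z : ℂ}
    (hz : z ∈ sector (π / 2 - β)) :
    ‖fourierBorel μ z‖ ≤ μ.variation.real univ := by
  have hlsmul : ‖(ContinuousLinearMap.lsmul ℝ ℂ : ℂ →L[ℝ] ℂ →L[ℝ] ℂ).flip‖ ≤ 1 :=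
    (ContinuousLinearMap.opNorm_flip _).trans_le ContinuousLinearMap.opNorm_lsmul_le
  refine (VectorMeasure.norm_integral_le_of_norm_le_const (C := 1) ?_).trans
    (mul_le_of_le_one_left measureReal_nonneg (by rwa [one_mul]))
  filter_upwards [hμβ] with ξ hξ
  rw [norm_exp, neg_mul, neg_re]
  exact Real.exp_le_one_iff.mpr (by linarith [(mul_mem_sector le_rfl hz hξ).1])

end FourierBorel

/-! ### Riesz integrals in a Banach algebra -/

section RieszIntegral

variable {U : Type*} [NormedRing U] [NormedAlgebra ℂ U]

/-- The Riesz integral `(2πi)⁻¹ ∮ g(z) (z - x)⁻¹ dz` over the circle of centre `c` and radius `R`.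
It is the holomorphic functional calculus of `x` applied to the function equal to `g` on the part
of the spectrum inside the circle and to `0` on the part outside. -/
def rieszIntegral (c : ℂ) (R : ℝ) (g : ℂ → ℂ) (x : U) : U :=
  (2 * π * I : ℂ)⁻¹ • ∮ z in C(c, R), g z • resolvent x z

variable {c : ℂ} {R : ℝ} {g : ℂ → ℂ} {x : U}

theorem algHom_resolvent (χ : U →ₐ[ℂ] ℂ) {z : ℂ} (hz : z ∈ resolventSet ℂ x) :
    χ (resolvent x z) = (z - χ x)⁻¹ := by
  have h := congrArg χ (Ring.inverse_mul_cancel _ hz)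
  rw [map_mul, map_sub, AlgHom.commutes, map_one] at h
  exact eq_inv_of_mul_eq_one_left h

variable [CompleteSpace U]

theorem circleIntegrable_smul_resolvent (hR : 0 ≤ R) (hg : ContinuousOn g (sphere c R))
    (hx : sphere c R ⊆ resolventSet ℂ x) :
    CircleIntegrable (fun z => g z • resolvent x z) c R :=
  (hg.smul fun _ hz => (spectrum.hasDerivAt_resolvent_const_left
    (hx hz)).continuousAt.continuousWithinAt).circleIntegrable hR

theorem algHom_rieszIntegral (hR : 0 ≤ R) (hg : ContinuousOn g (sphere c R))
    (hx : sphere c R ⊆ resolventSet ℂ x) (χ : U →ₐ[ℂ] ℂ) :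
    χ (rieszIntegral c R g x) =
      (2 * π * I : ℂ)⁻¹ * ∮ z in C(c, R), (z - χ x)⁻¹ • g z := by
  have hcomm : χ (∮ z in C(c, R), g z • resolvent x z) =
      ∮ z in C(c, R), χ (g z • resolvent x z) := by
    have := χ.toContinuousLinearMap.intervalIntegral_comp_comm
      (circleIntegrable_smul_resolvent hR hg hx).out
    simpa [circleIntegral] using this.symm
  rw [rieszIntegral, map_smul, hcomm, smul_eq_mul]
  congr 1
  refine circleIntegral.integral_congr hR fun z hz => ?_
  simp only [map_smul, algHom_resolvent χ (hx hz), smul_eq_mul, mul_comm]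

theorem algHom_rieszIntegral_of_mem_ball (hg : DiffContOnCl ℂ g (ball c R))
    (hx : sphere c R ⊆ resolventSet ℂ x) (χ : U →ₐ[ℂ] ℂ) (hχ : χ x ∈ ball c R) :
    χ (rieszIntegral c R g x) = g (χ x) := by
  have hR : 0 < R := pos_of_mem_ball hχ
  rw [algHom_rieszIntegral hR.le (hg.continuousOn_ball.mono sphere_subset_closedBall) hx]
  exact hg.two_pi_i_inv_smul_circleIntegral_sub_inv_smul hχ

theorem algHom_rieszIntegral_of_notMem_closedBall (hR : 0 ≤ R)
    (hg : DiffContOnCl ℂ g (ball c R)) (hx : sphere c R ⊆ resolventSet ℂ x) (χ : U →ₐ[ℂ] ℂ)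
    (hχ : χ x ∉ closedBall c R) : χ (rieszIntegral c R g x) = 0 := by
  have hinv : DiffContOnCl ℂ (fun z => (z - χ x)⁻¹) (ball c R) :=
    (differentiable_id.sub_const _).diffContOnCl.inv fun z hz h0 =>
      hχ (closure_ball_subset_closedBall (sub_eq_zero.mp h0 ▸ hz))
  rw [algHom_rieszIntegral hR (hg.continuousOn_ball.mono sphere_subset_closedBall) hx,
    (hinv.smul hg).circleIntegral_eq_zero hR, mul_zero]

end RieszIntegral

/-! ### Characters of Banach algebras -/

section Characters

variable {A : Type*} [NonUnitalNormedRing A] [NormedSpace ℂ A] [IsScalarTower ℂ A A]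
  [SMulCommClass ℂ A A]

/-- The extension of a character of `A` to the Banach algebra obtained by adjoining a unit. -/
def characterExtension (φ : A →ₙₐ[ℂ] ℂ) : WithLp 1 (Unitization ℂ A) →ₐ[ℂ] ℂ :=
  (Unitization.lift φ).comp (WithLp.unitizationAlgEquiv ℂ).toAlgHom

theorem characterExtension_toLp_inr (φ : A →ₙₐ[ℂ] ℂ) (a : A) :
    characterExtension φ (WithLp.toLp 1 (a : Unitization ℂ A)) = φ a := by
  simp [characterExtension]

theorem exists_characterExtension_eq (χ : WithLp 1 (Unitization ℂ A) →ₐ[ℂ] ℂ) :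
    ∃ φ : A →ₙₐ[ℂ] ℂ, characterExtension φ = χ := by
  refine ⟨Unitization.lift.symm (χ.comp (WithLp.unitizationAlgEquiv ℂ).symm.toAlgHom), ?_⟩
  rw [characterExtension, Equiv.apply_symm_apply]
  ext
  simp only [AlgHom.comp_apply]
  rfl

theorem exists_toLp_inr_eq {y : WithLp 1 (Unitization ℂ A)}
    (hy : characterExtension (0 : A →ₙₐ[ℂ] ℂ) y = 0) :
    ∃ a : A, WithLp.toLp 1 (a : Unitization ℂ A) = y := by
  refine ⟨y.ofLp.snd, WithLp.ofLp_injective _ (Unitization.ext ?_ ?_)⟩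
  · simpa [characterExtension, Unitization.lift] using hy.symm
  · simp

theorem spectrum_toLp (x : Unitization ℂ A) : spectrum ℂ (WithLp.toLp 1 x) = spectrum ℂ x :=
  (AlgEquiv.spectrum_eq (WithLp.unitizationAlgEquiv (A := A) (𝕜 := ℂ) ℂ) _).symm

theorem enorm_character_le_rho (φ : A →ₙₐ[ℂ] ℂ) (a : A) : ‖φ a‖ₑ ≤ rho a := by
  have hmem := AlgHom.apply_mem_spectrum (characterExtension φ)
    (WithLp.toLp 1 (a : Unitization ℂ A))
  rw [characterExtension_toLp_inr, spectrum_toLp] at hmem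
  exact le_iSup₂_of_le (φ a) hmem le_rfl

variable [CompleteSpace A]

theorem norm_character_le (φ : A →ₙₐ[ℂ] ℂ) (a : A) : ‖φ a‖ ≤ ‖a‖ := by
  have h := AlgHom.norm_apply_le_self_mul_norm_one (characterExtension φ)
    (WithLp.toLp 1 (a : Unitization ℂ A))
  have hone : ‖(1 : WithLp 1 (Unitization ℂ A))‖ = 1 := by
    change ‖WithLp.toLp 1 (1 : Unitization ℂ A)‖ = 1
    simp [WithLp.unitization_norm_def]
  rwa [characterExtension_toLp_inr, hone, mul_one, WithLp.unitization_norm_inr] at h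

theorem continuous_character (φ : A →ₙₐ[ℂ] ℂ) : Continuous φ :=
  AddMonoidHomClass.continuous_of_bound φ 1 fun a => by simpa using norm_character_le φ a

theorem spectralRadius_eq_of_isometry {U V : Type*} [NormedRing U] [NormedAlgebra ℂ U]
    [CompleteSpace U] [NormedRing V] [NormedAlgebra ℂ V] [CompleteSpace V] (J : U →ₐ[ℂ] V)
    (hJ : Isometry J) (x : U) : spectralRadius ℂ (J x) = spectralRadius ℂ x := by
  have h := spectrum.pow_nnnorm_pow_one_div_tendsto_nhds_spectralRadius (J x)
  simp only [← map_pow, hJ.nnnorm_map_of_map_zero (map_zero J)] at h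
  exact tendsto_nhds_unique h (spectrum.pow_nnnorm_pow_one_div_tendsto_nhds_spectralRadius x)

theorem rho_eq_of_isometry {A' : Type*} [NonUnitalNormedRing A'] [NormedSpace ℂ A']
    [IsScalarTower ℂ A' A'] [SMulCommClass ℂ A' A'] [CompleteSpace A'] (ι : A →ₙₐ[ℂ] A')
    (hι : Isometry ι) (a : A) : rho (ι a) = rho a := by
  let J : Unitization ℂ A →ₐ[ℂ] Unitization ℂ A' :=
    Unitization.lift ((Unitization.inrNonUnitalAlgHom ℂ A').comp ι)
  let J₁ : WithLp 1 (Unitization ℂ A) →ₐ[ℂ] WithLp 1 (Unitization ℂ A') :=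
    ((WithLp.unitizationAlgEquiv ℂ).symm.toAlgHom.comp J).comp
      (WithLp.unitizationAlgEquiv ℂ).toAlgHom
  have hJ₁ : Isometry J₁ := AddMonoidHomClass.isometry_of_norm J₁ fun x => by
    simp [J₁, J, WithLp.unitization_norm_def, hι.norm_map_of_map_zero (map_zero ι),
      Unitization.algebraMap_eq_inl]
  have ha : J₁ (WithLp.toLp 1 (a : Unitization ℂ A)) = WithLp.toLp 1 (ι a : Unitization ℂ A') := by
    have hJ : J a = (ι a : Unitization ℂ A') := by simp [J]
    exact congrArg (WithLp.toLp 1) hJ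
  have h := spectralRadius_eq_of_isometry J₁ hJ₁ (WithLp.toLp 1 (a : Unitization ℂ A))
  rwa [ha, spectralRadius, spectralRadius, spectrum_toLp, spectrum_toLp] at h

end Characters

section CommutativeCharacters

variable {A : Type*} [NonUnitalNormedCommRing A] [NormedSpace ℂ A] [IsScalarTower ℂ A A]
  [SMulCommClass ℂ A A] [CompleteSpace A]

theorem mem_rad_iff_forall_character {a : A} : a ∈ rad A ↔ ∀ φ : A →ₙₐ[ℂ] ℂ, φ a = 0 := by
  rw [mem_rad, rho_eq_zero_iff]
  refine ⟨fun h φ => (characterExtension_toLp_inr φ a).symm.trans (h _), fun h χ => ?_⟩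
  obtain ⟨φ, rfl⟩ := exists_characterExtension_eq χ
  rw [characterExtension_toLp_inr, h]

theorem exists_character_eq_of_mem_spectrum {a : A} {z : ℂ}
    (hz : z ∈ spectrum ℂ (WithLp.toLp 1 (a : Unitization ℂ A))) :
    ∃ φ : A →ₙₐ[ℂ] ℂ, φ a = z := by
  let := unitizationNormedCommRing A
  obtain ⟨χ, hχ⟩ := WeakDual.CharacterSpace.mem_spectrum_iff_exists.mp hz
  obtain ⟨φ, hφ⟩ := exists_characterExtension_eq (WeakDual.CharacterSpace.toAlgHom χ)
  exact ⟨φ, by rw [← characterExtension_toLp_inr, hφ]; exact hχ⟩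

theorem exists_forall_character_eq {a : A} {c : ℂ} {R : ℝ} {g : ℂ → ℂ} (hR : 0 ≤ R)
    (hg : DiffContOnCl ℂ g (ball c R)) (h0 : 0 ∉ closedBall c R)
    (ha : ∀ φ : A →ₙₐ[ℂ] ℂ, φ a ∉ sphere c R) :
    ∃ b : A, ∀ φ : A →ₙₐ[ℂ] ℂ, (φ a ∈ ball c R → φ b = g (φ a)) ∧
      (φ a ∉ closedBall c R → φ b = 0) := by
  set x : WithLp 1 (Unitization ℂ A) := WithLp.toLp 1 (a : Unitization ℂ A) with hx
  have hsphere : sphere c R ⊆ resolventSet ℂ x := fun z hz => by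
    by_contra hspec
    obtain ⟨φ, rfl⟩ := exists_character_eq_of_mem_spectrum hspec
    exact ha φ hz
  have hvanish := algHom_rieszIntegral_of_notMem_closedBall hR hg hsphere
  obtain ⟨b, hb⟩ := exists_toLp_inr_eq (hvanish (characterExtension 0) (by
    rwa [hx, characterExtension_toLp_inr]))
  refine ⟨b, fun φ => ?_⟩
  rw [← characterExtension_toLp_inr, ← characterExtension_toLp_inr, hb]
  exact ⟨algHom_rieszIntegral_of_mem_ball hg hsphere _, hvanish _⟩

end CommutativeCharacters

/-! ### Exponentials modulo the radical -/

section Exponential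

theorem norm_expTerm_le {Q : Type*} [NonUnitalNormedCommRing Q] [NormedSpace ℂ Q] (e v : Q)
    (k : ℕ) : ‖expTerm e v k‖ ≤ ‖e‖ * (‖v‖ ^ k / k.factorial) := by
  induction k with
  | zero => simp [expTerm]
  | succ k ih =>
    have hk : ‖((k + 1 : ℂ)⁻¹)‖ = ((k : ℝ) + 1)⁻¹ := by
      rw [norm_inv]
      norm_cast
    calc ‖expTerm e v (k + 1)‖
        ≤ ((k : ℝ) + 1)⁻¹ * (‖v‖ * (‖e‖ * (‖v‖ ^ k / k.factorial))) := by
          rw [expTerm, norm_smul, hk]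
          gcongr
          exact (norm_mul_le _ _).trans (by gcongr)
      _ = ‖e‖ * (‖v‖ ^ (k + 1) / (k + 1).factorial) := by
          rw [Nat.factorial_succ]
          push_cast
          field_simp
          ring

theorem summable_expTerm {Q : Type*} [NonUnitalNormedCommRing Q] [NormedSpace ℂ Q]
    [CompleteSpace Q] (e v : Q) : Summable (expTerm e v) :=
  .of_norm_bounded ((Real.summable_pow_div_factorial ‖v‖).mul_left _) (norm_expTerm_le e v)

variable {A : Type*} [NonUnitalNormedCommRing A] [NormedSpace ℂ A]

theorem character_expTerm (φ : A →ₙₐ[ℂ] ℂ) (e v : A) (k : ℕ) :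
    φ (expTerm e v k) = φ e * ((k.factorial : ℂ)⁻¹ * φ v ^ k) := by
  induction k with
  | zero => simp [expTerm]
  | succ k ih =>
    rw [expTerm, map_smul, map_mul, ih, Nat.factorial_succ, smul_eq_mul, pow_succ]
    push_cast
    rw [mul_inv]
    ring

variable [IsScalarTower ℂ A A] [SMulCommClass ℂ A A] [CompleteSpace A]

theorem mk_eq_mk_iff_forall_character {a b : A} :
    (Submodule.Quotient.mk a : A ⧸ rad A) = Submodule.Quotient.mk b ↔
      ∀ φ : A →ₙₐ[ℂ] ℂ, φ a = φ b := by
  simp only [Submodule.Quotient.eq, mem_rad_iff_forall_character, map_sub, sub_eq_zero]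

theorem mk_expTerm (e v : A) (k : ℕ) : (Submodule.Quotient.mk (expTerm e v k) : A ⧸ rad A) =
    expTerm (Submodule.Quotient.mk e) (Submodule.Quotient.mk v) k := by
  induction k with
  | zero => rfl
  | succ k ih => rw [expTerm, expTerm, Submodule.Quotient.mk_smul, ← ih, _root_.mk_mul_mk]

theorem hasSum_expTerm_mk {e v a : A} (h : ∀ φ : A →ₙₐ[ℂ] ℂ, φ a = φ e * exp (φ v)) :
    HasSum (expTerm (Submodule.Quotient.mk e) (Submodule.Quotient.mk v))
      (Submodule.Quotient.mk a : A ⧸ rad A) := by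
  obtain ⟨y, hy⟩ := summable_expTerm e v
  have hya : (Submodule.Quotient.mk y : A ⧸ rad A) = Submodule.Quotient.mk a := by
    refine mk_eq_mk_iff_forall_character.mpr fun φ => ?_
    have hφy : HasSum (fun k => φ (expTerm e v k)) (φ y) := hy.map φ (continuous_character φ)
    have hexp : HasSum (fun k => φ (expTerm e v k)) (φ e * exp (φ v)) := by
      simp only [character_expTerm]
      rw [exp_eq_exp_ℂ]
      exact (NormedSpace.exp_series_hasSum_exp' (𝕂 := ℂ) (φ v)).mul_left _
    rw [hφy.unique hexp, h φ]
  have hcont : Continuous (Submodule.Quotient.mk : A → A ⧸ rad A) := continuous_quot_mk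
  rw [← hya]
  exact (hy.map (rad A).mkQ.toAddMonoidHom hcont).congr_fun fun k => (mk_expTerm e v k).symm

end Exponential

/-! ### Scalar semigroups -/

section ScalarSemigroup

variable {U : Set ℂ} {h : ℂ → ℂ} {s t : ℂ}

theorem deriv_add_of_map_add (hU : IsOpen U) (hd : DifferentiableOn ℂ h U)
    (hadd : ∀ s ∈ U, ∀ t ∈ U, h (s + t) = h s * h t) (hs : s ∈ U) (ht : t ∈ U) :
    deriv h (s + t) = deriv h s * h t := by
  have heq : (fun s => h (s + t)) =ᶠ[𝓝 s] fun s => h s * h t :=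
    eventually_of_mem (hU.mem_nhds hs) fun s hs => hadd s hs t ht
  rw [← deriv_mul_const (hd.differentiableAt (hU.mem_nhds hs)), ← heq.deriv_eq,
    deriv_comp_add_const]

theorem exists_hasDerivAt_of_map_add (hU : IsOpen U) (hd : DifferentiableOn ℂ h U)
    (hadd : ∀ s ∈ U, ∀ t ∈ U, h (s + t) = h s * h t) (hs : s ∈ U) (hhs : h s ≠ 0) :
    ∃ l : ℂ, ∀ t ∈ U, HasDerivAt h (-l * h t) t := by
  refine ⟨-(deriv h s / h s), fun t ht => ?_⟩
  have hderiv : deriv h t = deriv h s / h s * h t := by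
    rw [div_mul_eq_mul_div, eq_div_iff hhs, ← deriv_add_of_map_add hU hd hadd ht hs, add_comm,
      deriv_add_of_map_add hU hd hadd hs ht]
  rw [neg_neg, ← hderiv]
  exact (hd.differentiableAt (hU.mem_nhds ht)).hasDerivAt

theorem exists_eq_exp_of_map_add (hU : IsOpen U) (hUc : IsPreconnected U)
    (hUadd : ∀ s ∈ U, ∀ t ∈ U, s + t ∈ U) (hd : DifferentiableOn ℂ h U)
    (hadd : ∀ s ∈ U, ∀ t ∈ U, h (s + t) = h s * h t) (hs : s ∈ U) (hhs : h s ≠ 0) :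
    ∃ l : ℂ, ∀ t ∈ U, h t = exp (-l * t) := by
  obtain ⟨l, hl⟩ := exists_hasDerivAt_of_map_add hU hd hadd hs hhs
  have hderiv : ∀ t ∈ U, HasDerivAt (fun t => h t * exp (l * t)) 0 t := fun t ht =>
    ((hl t ht).fun_mul ((hasDerivAt_id t).const_mul l).cexp).congr_deriv (by
      simp only [id_eq]
      ring)
  have hconst : ∀ t ∈ U, h t * exp (l * t) = h s * exp (l * s) := fun t ht =>
    hU.is_const_of_deriv_eq_zero hUc
      (fun t ht => (hderiv t ht).differentiableAt.differentiableWithinAt)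
      (fun t ht => (hderiv t ht).deriv) ht hs
  have hone : h s * exp (l * s) = 1 := by
    have hsq := hconst _ (hUadd s hs s hs)
    rw [hadd s hs s hs, mul_add, exp_add] at hsq
    refine mul_left_cancel₀ (mul_ne_zero hhs (exp_ne_zero (l * s))) ?_
    linear_combination hsq
  refine ⟨l, fun t ht => ?_⟩
  rw [neg_mul, exp_neg]
  exact eq_inv_of_mul_eq_one_left ((hconst t ht).trans hone)

end ScalarSemigroup

/-! ### Bounded generators modulo the radical -/

section BoundedGenerator

variable {A : Type*} [NonUnitalNormedCommRing A] [NormedSpace ℂ A] [IsScalarTower ℂ A A]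
  [SMulCommClass ℂ A A] [CompleteSpace A]

theorem exists_forall_character_eq_one_and_eq_log {a : A}
    (ha : ∀ φ : A →ₙₐ[ℂ] ℂ, φ = 0 ∨ φ a ∈ ball 1 (1 / 2)) :
    ∃ e v : A, ∀ φ : A →ₙₐ[ℂ] ℂ, φ = 0 ∨ φ e = 1 ∧ φ v = log (φ a) := by
  have h0 : (0 : ℂ) ∉ closedBall 1 (1 / 2) := by norm_num
  have hsphere : ∀ φ : A →ₙₐ[ℂ] ℂ, φ a ∉ sphere 1 (1 / 2) := fun φ hφ => by
    rcases ha φ with rfl | h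
    · exact h0 (sphere_subset_closedBall hφ)
    · exact (mem_ball.mp h).ne hφ
  have hlog : DifferentiableOn ℂ log (closure (ball 1 (1 / 2))) := fun z hz =>
    (differentiableAt_log (ball_one_subset_slitPlane (closedBall_subset_ball (by norm_num)
      (closure_ball_subset_closedBall hz)))).differentiableWithinAt
  obtain ⟨e, he⟩ := exists_forall_character_eq (by norm_num) (diffContOnCl_const (c := (1 : ℂ)))
    h0 hsphere
  obtain ⟨v, hv⟩ := exists_forall_character_eq (by norm_num) hlog.diffContOnCl h0 hsphere
  exact ⟨e, v, fun φ => (ha φ).imp_right fun h => ⟨(he φ).1 h, (hv φ).1 h⟩⟩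

theorem mk_mul_mk_eq_and_mul_mk_eq {e : A} (he : ∀ φ : A →ₙₐ[ℂ] ℂ, φ = 0 ∨ φ e = 1)
    (x : A ⧸ rad A) : Submodule.Quotient.mk e * x = x ∧ x * Submodule.Quotient.mk e = x := by
  obtain ⟨x, rfl⟩ := Submodule.Quotient.mk_surjective _ x
  rw [mul_comm (Submodule.Quotient.mk x), and_self, _root_.mk_mul_mk, mk_eq_mk_iff_forall_character]
  intro φ
  rcases he φ with rfl | h
  · rfl
  · rw [map_mul, h, one_mul]

theorem exists_unit_hasBoundedGenerator {α R : ℝ} (hα : 0 < α) {S : sector α → A}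
    (hS : ∀ φ : A →ₙₐ[ℂ] ℂ, φ = 0 ∨ ∃ l : ℂ, ‖l‖ ≤ R ∧ ∀ t, φ (S t) = exp (-l * t)) :
    ∃ e : A ⧸ rad A, (∀ x, e * x = x ∧ x * e = x) ∧
      HasBoundedGenerator e fun t => (Submodule.Quotient.mk (S t) : A ⧸ rad A) := by
  obtain ⟨τ, hτ, hRτ⟩ : ∃ τ : ℝ, 0 < τ ∧ R * τ < 1 / 4 :=
    ⟨(4 * (|R| + 1))⁻¹, by positivity, by
      rw [mul_inv_lt_iff₀ (by positivity)]
      linarith [le_abs_self R]⟩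
  have hsmall : ∀ l : ℂ, ‖l‖ ≤ R → ‖-l * τ‖ < 1 / 4 := fun l hl => by
    rw [norm_mul, norm_neg, norm_real, Real.norm_of_nonneg hτ.le]
    exact (mul_le_mul_of_nonneg_right hl hτ.le).trans_lt hRτ
  have hball : ∀ φ : A →ₙₐ[ℂ] ℂ, φ = 0 ∨ φ (S ⟨τ, ofReal_mem_sector hα hτ⟩) ∈ ball 1 (1 / 2) :=
    fun φ => (hS φ).imp_right fun ⟨l, hl, hφ⟩ => by
      rw [hφ, mem_ball, dist_eq_norm]
      linarith [norm_exp_sub_one_le (x := -l * τ) (by linarith [hsmall l hl]), hsmall l hl]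
  obtain ⟨e, v, hev⟩ := exists_forall_character_eq_one_and_eq_log hball
  refine ⟨Submodule.Quotient.mk e, mk_mul_mk_eq_and_mul_mk_eq fun φ => (hev φ).imp_right And.left,
    Submodule.Quotient.mk ((τ : ℂ)⁻¹ • v), fun t => ?_⟩
  rw [← Submodule.Quotient.mk_smul]
  refine hasSum_expTerm_mk fun φ => ?_
  rcases hS φ with rfl | ⟨l, hl, hφ⟩
  · simp
  rcases hev φ with rfl | ⟨he, hv⟩
  · simp
  have him := abs_lt.mp ((abs_im_le_norm (-l * τ)).trans_lt (hsmall l hl))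
  have hlog : log (exp (-l * τ)) = -l * τ :=
    log_exp (by linarith [Real.pi_gt_three]) (by linarith [Real.pi_gt_three])
  have hτ' : (τ : ℂ) ≠ 0 := ofReal_ne_zero.mpr hτ.ne'
  rw [map_smul, map_smul, he, hv, hφ, hφ, hlog, one_mul, smul_eq_mul, smul_eq_mul]
  congr 1
  field_simp

end BoundedGenerator

/-! ### Characters of the algebra generated by an analytic semigroup -/

namespace AnalyticSemigroup

variable {α : ℝ} {B : Type*} [NonUnitalNormedRing B] [NormedSpace ℂ B] (T : AnalyticSemigroup α B)

theorem continuousOn_comp_mul {β : ℝ} {K : Set ℂ} {u : ℂ} (hα : α ≤ π / 2)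
    (hKβ : K ⊆ closedSector β) (hu : u ∈ sector (α - β)) : ContinuousOn (fun ξ => T (u * ξ)) K :=
  T.differentiableOn.continuousOn.comp (by fun_prop) fun _ hξ => mul_mem_sector hα hu (hKβ hξ)

variable [IsScalarTower ℂ B B] [SMulCommClass ℂ B B]

theorem toAlgebra_add (s t : sector α) (hst : (s + t : ℂ) ∈ sector α) :
    T.toAlgebra ⟨s + t, hst⟩ = T.toAlgebra s * T.toAlgebra t :=
  Subtype.ext (T.map_add s s.2 t t.2)

variable [CompleteSpace B] {T} {φ : T.algebra →ₙₐ[ℂ] ℂ}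

theorem enorm_character_le_rho_coe (φ : T.algebra →ₙₐ[ℂ] ℂ) (a : T.algebra) :
    ‖φ a‖ₑ ≤ rho (a : B) := by
  have h := rho_eq_of_isometry (NonUnitalSubalgebraClass.subtype T.algebra) isometry_subtype_coe a
  exact (enorm_character_le_rho φ a).trans_eq h.symm

theorem exists_continuousLinearMap_eq_character (φ : T.algebra →ₙₐ[ℂ] ℂ) :
    ∃ G : B →L[ℂ] ℂ, ∀ a : T.algebra, G a = φ a := by
  let ψ : StrongDual ℂ T.algebra.toSubmodule := ⟨LinearMapClass.linearMap φ, continuous_character φ⟩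
  obtain ⟨G, hG, -⟩ := exists_extension_norm_eq T.algebra.toSubmodule ψ
  exact ⟨G, hG⟩

theorem character_eq_zero_of_forall_toAlgebra (h : ∀ t, φ (T.toAlgebra t) = 0) : φ = 0 := by
  let N : NonUnitalSubalgebra ℂ B :=
    (NonUnitalAlgHom.equalizer φ 0).map (NonUnitalSubalgebraClass.subtype T.algebra)
  have hgen : T '' sector α ⊆ N := by
    rintro _ ⟨t, ht, rfl⟩
    exact ⟨T.toAlgebra ⟨t, ht⟩, h _, rfl⟩
  have hN : IsClosed (N : Set B) :=
    (NonUnitalSubalgebra.isClosed_topologicalClosure _).isClosedEmbedding_subtypeVal.isClosedMap _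
      (isClosed_eq (continuous_character φ) continuous_const)
  ext a
  obtain ⟨b, hb, hba⟩ := NonUnitalSubalgebra.topologicalClosure_minimal
    (NonUnitalAlgebra.adjoin_le hgen) hN a.2
  rwa [← Subtype.ext hba]

/-- The character `φ` has exponent `l` if it takes `T(t)` to `exp (-l t)`: formally, `φ(A) = -l`
for the generator `A` of `T`. -/
def IsExponent (φ : T.algebra →ₙₐ[ℂ] ℂ) (l : ℂ) : Prop :=
  ∀ t : sector α, φ (T.toAlgebra t) = exp (-l * t)

variable (T) in
/-- The exponents of the characters of the algebra generated by `T`, which play the role of the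
spectrum of `-A`, where `A` is the generator of `T`. -/
def exponents : Set ℂ := {l | ∃ φ : T.algebra →ₙₐ[ℂ] ℂ, IsExponent φ l}

theorem character_eq_zero_or_exists_isExponent (hα₀ : 0 < α) (hα : α ≤ π / 2)
    (φ : T.algebra →ₙₐ[ℂ] ℂ) : φ = 0 ∨ ∃ l, IsExponent φ l := by
  obtain ⟨G, hG⟩ := exists_continuousLinearMap_eq_character φ
  have hGT (t : sector α) : G (T t) = φ (T.toAlgebra t) := hG (T.toAlgebra t)
  have hadd : ∀ s ∈ sector α, ∀ t ∈ sector α, G (T (s + t)) = G (T s) * G (T t) :=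
    fun s hs t ht => by
      rw [hGT ⟨s, hs⟩, hGT ⟨t, ht⟩, ← map_mul, ← T.toAlgebra_add, hGT ⟨s + t, _⟩]
      exact add_mem_sector hα₀ hα hs ht
  refine or_iff_not_imp_left.mpr fun hφ => ?_
  obtain ⟨s, hs⟩ := not_forall.mp (mt character_eq_zero_of_forall_toAlgebra hφ)
  obtain ⟨l, hl⟩ := exists_eq_exp_of_map_add (isOpen_sector hα₀ hα)
    (convex_sector hα₀ hα).isPreconnected (fun s hs t ht => add_mem_sector hα₀ hα hs ht)
    (G.differentiable.comp_differentiableOn T.differentiableOn) hadd s.2 ((hGT s).trans_ne hs)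
  exact ⟨l, fun t => (hGT t).symm.trans (hl t t.2)⟩

theorem bddBelow_re_mul_exponents {t : ℂ} (ht : t ∈ sector α) :
    BddBelow ((fun l => (l * t).re) '' T.exponents) := by
  refine ⟨-Real.log ‖T t‖, ?_⟩
  rintro _ ⟨l, ⟨φ, hφ⟩, rfl⟩
  have hle : Real.exp (-(l * t).re) ≤ ‖T t‖ := by
    have h := norm_character_le φ (T.toAlgebra ⟨t, ht⟩)
    rwa [hφ, norm_exp, neg_mul, neg_re] at h
  exact neg_le.mp ((Real.le_log_iff_exp_le ((Real.exp_pos _).trans_le hle)).mpr hle)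

theorem exists_unit_hasBoundedGenerator (hα₀ : 0 < α) (hα : α ≤ π / 2)
    (hT : IsBounded T.exponents) :
    ∃ e : T.algebra ⧸ rad T.algebra, (∀ x, e * x = x ∧ x * e = x) ∧
      HasBoundedGenerator e fun t : sector α =>
        (Submodule.Quotient.mk (T.toAlgebra t) : T.algebra ⧸ rad T.algebra) := by
  obtain ⟨R, hR⟩ := hT.exists_norm_le
  exact _root_.exists_unit_hasBoundedGenerator hα₀ fun φ =>
    (character_eq_zero_or_exists_isExponent hα₀ hα φ).imp_right fun ⟨l, hl⟩ => ⟨l, hR l ⟨φ, hl⟩, hl⟩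

theorem exists_coe_eq_functionalCalculus {β : ℝ} {K : Set ℂ} {μ : ComplexMeasure ℂ} {u : ℂ}
    (hα : α ≤ π / 2) (hK : IsCompact K) (hKβ : K ⊆ closedSector β)
    (hμK : ∀ᵐ ξ ∂μ.variation, ξ ∈ K) (hu : u ∈ sector (α - β)) :
    ∃ a : T.algebra, (a : B) = functionalCalculus T μ u ∧
      ∀ (φ : T.algebra →ₙₐ[ℂ] ℂ) (l : ℂ), IsExponent φ l → φ a = fourierBorel μ (l * u) := by
  classical
  let g : ℂ → T.algebra := fun ξ => if h : u * ξ ∈ sector α then T.toAlgebra ⟨u * ξ, h⟩ else 0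
  have hg (ξ : ℂ) (hξ : ξ ∈ K) : ∃ t : sector α, t = u * ξ ∧ g ξ = T.toAlgebra t :=
    ⟨⟨u * ξ, mul_mem_sector hα hu (hKβ hξ)⟩, rfl, dif_pos _⟩
  have hgT (ξ : ℂ) (hξ : ξ ∈ K) : (g ξ : B) = T (u * ξ) := by
    obtain ⟨t, ht, hgt⟩ := hg ξ hξ
    rw [hgt, ← ht, toAlgebra]
  have hgi : μ.Integrable g := by
    refine integrable_of_continuousOn hK hμK ?_
    rw [Topology.IsInducing.subtypeVal.continuousOn_iff]
    exact (T.continuousOn_comp_mul hα hKβ hu).congr hgT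
  refine ⟨cintegral μ g, ?_, fun φ l hl => ?_⟩
  · let ι : T.algebra →L[ℂ] B := T.algebra.toSubmodule.subtypeL
    refine (map_cintegral ι hgi).trans (VectorMeasure.integral_congr_ae ?_)
    filter_upwards [hμK] with ξ hξ using hgT ξ hξ
  · let L : T.algebra →L[ℂ] ℂ := ⟨LinearMapClass.linearMap φ, continuous_character φ⟩
    refine (map_cintegral L hgi).trans (VectorMeasure.integral_congr_ae ?_)
    filter_upwards [hμK] with ξ hξ
    obtain ⟨t, ht, hgt⟩ := hg ξ hξ
    change φ (g ξ) = exp (-(l * u) * ξ)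
    rw [hgt, hl t, ht, ← mul_assoc, neg_mul]

end AnalyticSemigroup

/-! ### The product of a Fourier-Borel transform with its conjugate -/

section SymmFourierBorel

/-- The entire function `f · f~`, where `f` is the Fourier-Borel transform of `μ` and
`f~(z) = conj (f (conj z))`. -/
def symmFourierBorel (μ : ComplexMeasure ℂ) (z : ℂ) : ℂ :=
  fourierBorel μ z * conj (fourierBorel μ (conj z))

variable {α β : ℝ} {K : Set ℂ} {μ : ComplexMeasure ℂ}

theorem norm_symmFourierBorel_conj (z : ℂ) :
    ‖symmFourierBorel μ (conj z)‖ = ‖symmFourierBorel μ z‖ := by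
  simp [symmFourierBorel, mul_comm]

theorem differentiable_symmFourierBorel (hK : IsCompact K) (hμK : ∀ᵐ ξ ∂μ.variation, ξ ∈ K) :
    Differentiable ℂ (symmFourierBorel μ) := by
  have hf := differentiable_fourierBorel hK hμK
  exact hf.mul fun z => differentiableAt_conj_conj_iff.mpr (hf _)

theorem norm_symmFourierBorel_le (hμβ : ∀ᵐ ξ ∂μ.variation, ξ ∈ closedSector β) {z : ℂ}
    (hz : z ∈ sector (π / 2 - β)) : ‖symmFourierBorel μ z‖ ≤ μ.variation.real univ ^ 2 := by
  rw [symmFourierBorel, norm_mul, RCLike.norm_conj, sq]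
  have h := norm_fourierBorel_le hμβ hz
  have h' := norm_fourierBorel_le hμβ (conj_mem_sector hz)
  gcongr

theorem AnalyticSemigroup.enorm_symmFourierBorel_le_rho {B : Type*} [NonUnitalNormedRing B]
    [NormedSpace ℂ B] [IsScalarTower ℂ B B] [SMulCommClass ℂ B B] [CompleteSpace B]
    {T : AnalyticSemigroup α B} (hα : α ≤ π / 2) (hK : IsCompact K) (hKβ : K ⊆ closedSector β)
    (hμK : ∀ᵐ ξ ∂μ.variation, ξ ∈ K) {l t : ℂ} (hl : l ∈ T.exponents) (ht : t ∈ sector (α - β)) :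
    ‖symmFourierBorel μ (l * t)‖ₑ ≤
      rho (functionalCalculus T μ t * functionalCalculus T (conjMeasure μ) t) := by
  obtain ⟨φ, hφ⟩ := hl
  obtain ⟨a, ha, hφa⟩ := exists_coe_eq_functionalCalculus (T := T) hα hK hKβ hμK ht
  obtain ⟨b, hb, hφb⟩ := exists_coe_eq_functionalCalculus (T := T) hα
    (conjCLE.toHomeomorph.isCompact_preimage.mpr hK)
    (fun ξ hξ => by simpa using conj_mem_closedSector (hKβ hξ))
    (ae_mem_conjMeasure hK.measurableSet hμK) ht
  have hφab : φ (a * b) = symmFourierBorel μ (l * t) := by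
    rw [map_mul, hφa φ l hφ, hφb φ l hφ, fourierBorel_conjMeasure hK hμK, symmFourierBorel]
  rw [← hφab, ← ha, ← hb]
  exact enorm_character_le_rho_coe φ (a * b)

end SymmFourierBorel

theorem mainTheorem5_general {B : Type*} [NonUnitalNormedRing B] [NormedSpace ℂ B]
    [IsScalarTower ℂ B B] [SMulCommClass ℂ B B] [CompleteSpace B] (α β : ℝ) (hα₀ : 0 < α)
    (hα : α ≤ π / 2) (hβ : 0 ≤ β) (μ : ComplexMeasure ℂ) (K : Set ℂ) (hK : IsCompact K)
    (hKβ : K ⊆ closedSector β) (hμK : ∀ E : Set ℂ, MeasurableSet E → Disjoint E K → μ E = 0)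
    (T : AnalyticSemigroup α B) (t₀ : ℝ) (ht₀ : 0 < t₀)
    (hsup : (⨆ t ∈ {t : ℂ | t ∈ sector (α - β) ∧ ‖t‖ ≤ t₀},
        rho (functionalCalculus T μ t * functionalCalculus T (conjMeasure μ) t)) <
      ⨆ z ∈ sector (α - β), ‖fourierBorel μ z‖ₑ * ‖conj (fourierBorel μ (conj z))‖ₑ) :
    ∃ e : T.algebra ⧸ rad T.algebra, (∀ x, e * x = x ∧ x * e = x) ∧
      HasBoundedGenerator e fun t : sector α =>
        (Submodule.Quotient.mk (T.toAlgebra t) : T.algebra ⧸ rad T.algebra) := by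
  have hμK' := ae_mem_of_forall_disjoint hK.measurableSet hμK
  obtain ⟨C, hC, hCF⟩ := ENNReal.lt_iff_exists_nnreal_btwn.mp hsup
  simp only [lt_iSup_iff] at hCF
  obtain ⟨z, hz, hCz⟩ := hCF
  have hCz' : C < ‖symmFourierBorel μ z‖ := by
    rw [← enorm_mul] at hCz
    exact coe_lt_enorm.mp hCz
  have hsmall : ∀ t ∈ sector (α - β), ‖t‖ ≤ t₀ → ∀ l ∈ T.exponents,
      ‖symmFourierBorel μ (l * t)‖ₑ ≤ C := fun t ht htt₀ l hl =>
    calc ‖symmFourierBorel μ (l * t)‖ₑ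
      _ ≤ rho (functionalCalculus T μ t * functionalCalculus T (conjMeasure μ) t) :=
        AnalyticSemigroup.enorm_symmFourierBorel_le_rho hα hK hKβ hμK' hl ht
      _ ≤ _ := le_iSup₂_of_le t ⟨ht, htt₀⟩ le_rfl
      _ ≤ C := hC.le
  refine AnalyticSemigroup.exists_unit_hasBoundedGenerator hα₀ hα ?_
  exact isBounded_of_forall_norm_mul_le hα₀ hα hβ (differentiable_symmFourierBorel hK hμK')
    norm_symmFourierBorel_conj
    (fun w hw => norm_symmFourierBorel_le (hμK'.mono hKβ) hw)
    (fun t ht => AnalyticSemigroup.bddBelow_re_mul_exponents ht) ht₀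
    (fun t ht htt₀ l hl => enorm_le_coe.mp (hsmall t ht htt₀ l hl)) hz hCz'

end

theorem mainTheorem5 {B : Type*} [NonUnitalNormedRing B] [NormedSpace ℂ B] [IsScalarTower ℂ B B]
    [SMulCommClass ℂ B B] [CompleteSpace B] (α β : ℝ) (hα : 0 < α) (hα' : α < Real.pi / 2)
    (hβ : 0 ≤ β) (hβα : β < α)
    (μ : ComplexMeasure ℂ) (K : Set ℂ) (hK : IsCompact K) (hKβ : K ⊆ closedSector β)
    (hμK : ∀ E : Set ℂ, MeasurableSet E → Disjoint E K → μ E = 0)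
    (hμ0 : μ Set.univ = 0)
    (T : AnalyticSemigroup α B) (hT : ¬ T.IsQuasinilpotent)
    (t₀ : ℝ) (ht₀ : 0 < t₀)
    (hsup : (⨆ t ∈ {t : ℂ | t ∈ sector (α - β) ∧ ‖t‖ ≤ t₀},
        rho (functionalCalculus T μ t * functionalCalculus T (conjMeasure μ) t)) <
      ⨆ z ∈ sector (α - β), ‖fourierBorel μ z‖ₑ * ‖conj (fourierBorel μ (conj z))‖ₑ) :
    ∃ e : T.algebra ⧸ rad T.algebra, (∀ x, e * x = x ∧ x * e = x) ∧
      HasBoundedGenerator e fun t : sector α =>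
        (Submodule.Quotient.mk (T.toAlgebra t) : T.algebra ⧸ rad T.algebra) :=
  mainTheorem5_general α β hα hα'.le hβ μ K hK hKβ hμK T t₀ ht₀ hsup
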